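/- Let $d>2$ be an integer, let $S^{d-1}$ be the unit sphere of $\mathbb{R}^d$, and let $\omega$ be a Haar measure on $S^{d-1}$, i.e. a nonzero finite Borel measure on $S^{d-1}$ that is invariant under the orthogonal group $\operatorname{O}(d)$. Let $p\in\mathbb{R}[x_1,\dots,x_d]$ be a real polynomial that is even on the sphere, i.e. $p(-x)=p(x)$ for all $x\in S^{d-1}$ (equivalently, $p|_{S^{d-1}}$ is invariant under $G=\{\pm I\}\leq \operatorname{O}(d)$). Then there is an even polynomial $q\in\mathbb{R}[x_1,\dots,x_d]$, i.e. $q(-y)=q(y)$ for all $y\in\mathbb{R}^d$, such that \[ p(x)=\int_{S^{d-1}} q(y)\,|\langle x,y\rangle|\,d\omega(y) \qquad\text{for all } x\in S^{d-1}. \] -/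

import Mathlib

/-- The action of a linear isometry `g ∈ O(d)` on the unit sphere of `ℝ^d`. -/
noncomputable def sphereRotate {d : ℕ}
    (g : EuclideanSpace ℝ (Fin d) ≃ₗᵢ[ℝ] EuclideanSpace ℝ (Fin d))
    (x : Metric.sphere (0 : EuclideanSpace ℝ (Fin d)) 1) :
    Metric.sphere (0 : EuclideanSpace ℝ (Fin d)) 1 :=
  ⟨g x.1, by
    have hx := x.2
    rw [mem_sphere_zero_iff_norm] at hx ⊢
    rw [g.norm_map, hx]⟩

/-- `ω` is a Haar measure on the unit sphere `S^{d-1}` of `ℝ^d`: a nonzero finite Borel measure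
that is invariant under the orthogonal group `O(d)`. No normalization is imposed. -/
structure IsSphereHaar {d : ℕ}
    (ω : MeasureTheory.Measure (Metric.sphere (0 : EuclideanSpace ℝ (Fin d)) 1)) : Prop where
  finite : MeasureTheory.IsFiniteMeasure ω
  ne_zero : ω ≠ 0
  invariant : ∀ g : EuclideanSpace ℝ (Fin d) ≃ₗᵢ[ℝ] EuclideanSpace ℝ (Fin d),
    ω.map (sphereRotate g) = ω

/-- The value of a real polynomial in `d` variables at a point of `ℝ^d`. -/
noncomputable def polyEval {d : ℕ} (p : MvPolynomial (Fin d) ℝ)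
    (x : EuclideanSpace ℝ (Fin d)) : ℝ :=
  MvPolynomial.eval (fun i => x i) p

open MeasureTheory

/-! The cosine transform is computed on the even powers `⟨a,y⟩^(2k)`, with `a` a unit vector. For
`x` at angle `φ` from `a`, invariance permits averaging over rotations of a plane containing `x` and
`a`. Polar coordinates there split the integral into a nonzero constant depending only on `k` and
the circle integral of `cos(θ-φ)^(2k) |cos θ|` (`IsSphereHaar.integral_pow_mul_abs_inner`). After
rescaling each power, the range contains the circle transform of every polynomial in `cos(θ-φ)^2`.

On the circle, `cos(2nφ)` is an eigenfunction with nonzero eigenvalue. Since Chebyshev polynomials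
span, every polynomial in `2⟨a,x⟩^2 - 1` is in the range (`IsSphereHaar.zonal_mem_cosineRange`), in
particular `⟨a,x⟩^(2k)`. Polarization then gives all monomials of even degree, hence all even
polynomials. -/

/-! ### Chebyshev polynomials and the transform on the circle -/

open Polynomial in
theorem span_range_chebyshev_T :
    Submodule.span ℝ (Set.range (fun j : ℤ => Chebyshev.T ℝ j)) = ⊤ := by
  set S := Submodule.span ℝ (Set.range (fun j : ℤ => Chebyshev.T ℝ j)) with hS
  have hT : ∀ j : ℤ, Chebyshev.T ℝ j ∈ S := fun j => Submodule.subset_span ⟨j, rfl⟩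
  -- The recurrence `X T_j = (T_{j+1} + T_{j-1}) / 2` holds for every integer `j`, so `j = 0` is no
  -- exception.
  have hX : ∀ p ∈ S, X * p ∈ S := by
    intro p hp
    induction hp using Submodule.span_induction with
    | mem p hp =>
      obtain ⟨j, rfl⟩ := hp
      have h : X * Chebyshev.T ℝ j =
          (1 / 2 : ℝ) • (Chebyshev.T ℝ (j + 1) + Chebyshev.T ℝ (j - 1)) := by
        rw [Chebyshev.T_add_one, sub_add_cancel, show (2 : ℝ[X]) = C 2 from (map_ofNat C 2).symm,
          mul_assoc,
          ← smul_eq_C_mul, smul_smul]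
        norm_num
      simp only [h]
      exact S.smul_mem _ (S.add_mem (hT _) (hT _))
    | zero => simp
    | add p q _ _ hp hq => rw [mul_add]; exact S.add_mem hp hq
    | smul c p _ hp => rw [mul_smul_comm]; exact S.smul_mem _ hp
  have hpow : ∀ n : ℕ, (X : ℝ[X]) ^ n ∈ S := by
    intro n
    induction n with
    | zero => simpa using hT 0
    | succ n ih => rw [pow_succ']; exact hX _ ih
  refine eq_top_iff.2 fun p _ => ?_
  rw [p.as_sum_range_C_mul_X_pow]
  refine S.sum_mem fun i _ => ?_
  rw [← smul_eq_C_mul]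
  exact S.smul_mem _ (hpow i)

theorem Int.two_mul_add_one_cast_ne_zero (j : ℤ) : (2 * j + 1 : ℝ) ≠ 0 := by
  have : (2 * j + 1 : ℤ) ≠ 0 := by omega
  exact_mod_cast this

theorem Int.two_mul_sub_one_cast_ne_zero (j : ℤ) : (2 * j - 1 : ℝ) ≠ 0 := by
  have : (2 * j - 1 : ℤ) ≠ 0 := by omega
  exact_mod_cast this

open Real in
theorem integral_pi_periodic_eq {g : ℝ → ℝ} (hg : Function.Periodic g π) (t : ℝ) :
    ∫ θ in (0 : ℝ)..π, g (θ + t) = ∫ θ in (0 : ℝ)..π, g θ := by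
  rw [intervalIntegral.integral_comp_add_right, zero_add, add_comm π t,
    hg.intervalIntegral_add_eq t 0, zero_add]

-- By periodicity the interval may be moved to `[-π/2, π/2]`, where `|cos| = cos`; product-to-sum
-- formulas finish. The factor is the eigenvalue at frequency `2j`.
open Real in
theorem integral_cos_two_int_mul_sub_mul_abs_cos (j : ℤ) (φ : ℝ) :
    ∫ θ in (0 : ℝ)..π, cos (j * (2 * (θ - φ))) * |cos θ| =
      ((-1) ^ j * (1 / (2 * j + 1) - 1 / (2 * j - 1))) * cos (j * (2 * φ)) := by
  have h1 := Int.two_mul_add_one_cast_ne_zero j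
  have h2 := Int.two_mul_sub_one_cast_ne_zero j
  have hper : Function.Periodic (fun θ => cos (j * (2 * (θ - φ))) * |cos θ|) π := by
    intro θ
    have : (j * (2 * (θ + π - φ)) : ℝ) = j * (2 * (θ - φ)) + j * (2 * π) := by ring
    simp only [this, cos_add_int_mul_two_pi, cos_add_pi, abs_neg]
  have hshift := hper.intervalIntegral_add_eq 0 (-(π / 2))
  rw [zero_add, show -(π / 2) + π = π / 2 by ring] at hshift
  rw [hshift]
  have habs : ∫ θ in (-(π / 2))..(π / 2), cos (j * (2 * (θ - φ))) * |cos θ| =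
      ∫ θ in (-(π / 2))..(π / 2), cos (j * (2 * (θ - φ))) * cos θ := by
    refine intervalIntegral.integral_congr fun θ hθ => ?_
    rw [Set.uIcc_of_le (by linarith [pi_pos])] at hθ
    simp only [abs_of_nonneg (cos_nonneg_of_mem_Icc hθ)]
  rw [habs]
  have hderiv : ∀ θ ∈ Set.uIcc (-(π / 2)) (π / 2), HasDerivAt
      (fun θ => sin ((2 * j + 1) * θ - j * (2 * φ)) / (2 * (2 * j + 1)) +
        sin ((2 * j - 1) * θ - j * (2 * φ)) / (2 * (2 * j - 1)))
      (cos (j * (2 * (θ - φ))) * cos θ) θ := by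
    intro θ _
    have hd : ∀ c : ℝ, HasDerivAt (fun θ => sin (c * θ - j * (2 * φ)))
        (cos (c * θ - j * (2 * φ)) * c) θ := fun c => by
      simpa using (((hasDerivAt_id θ).const_mul c).sub_const (j * (2 * φ))).sin
    refine (((hd (2 * j + 1)).div_const (2 * (2 * j + 1))).add
      ((hd (2 * j - 1)).div_const (2 * (2 * j - 1)))).congr_deriv ?_
    rw [show (2 * j + 1) * θ - j * (2 * φ) = j * (2 * (θ - φ)) + θ by ring,
      show (2 * j - 1) * θ - j * (2 * φ) = j * (2 * (θ - φ)) - θ by ring,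
      mul_div_mul_right _ _ h1, mul_div_mul_right _ _ h2, cos_add,
      cos_sub]
    ring
  rw [intervalIntegral.integral_eq_sub_of_hasDerivAt hderiv
    (Continuous.intervalIntegrable (by fun_prop) _ _)]
  have e1 : sin ((2 * j + 1) * (π / 2) - j * (2 * φ)) = (-1) ^ j * cos (j * (2 * φ)) := by
    rw [show (2 * j + 1) * (π / 2) - j * (2 * φ) = (π / 2 - j * (2 * φ)) + j * π by ring,
      sin_add_int_mul_pi, sin_pi_div_two_sub]
  have e2 : sin ((2 * j - 1) * (π / 2) - j * (2 * φ)) = -((-1) ^ j * cos (j * (2 * φ))) := by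
    rw [show (2 * j - 1) * (π / 2) - j * (2 * φ) = -(π / 2 + j * (2 * φ)) + j * π by ring,
      sin_add_int_mul_pi, sin_neg, add_comm (π / 2), sin_add_pi_div_two]
    ring
  have e3 : sin ((2 * j + 1) * (-(π / 2)) - j * (2 * φ)) = -((-1) ^ j * cos (j * (2 * φ))) := by
    rw [show (2 * j + 1) * (-(π / 2)) - j * (2 * φ) = -(π / 2 + j * (2 * φ)) - j * π by ring,
      sin_sub_int_mul_pi, sin_neg, add_comm (π / 2), sin_add_pi_div_two]
    ring
  have e4 : sin ((2 * j - 1) * (-(π / 2)) - j * (2 * φ)) = (-1) ^ j * cos (j * (2 * φ)) := by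
    rw [show (2 * j - 1) * (-(π / 2)) - j * (2 * φ) = (π / 2 - j * (2 * φ)) - j * π by ring,
      sin_sub_int_mul_pi, sin_pi_div_two_sub]
  rw [e1, e2, e3, e4]
  field_simp
  ring

/-- The bracket equals `-2 / ((2j+1)(2j-1))`: no even frequency is lost. -/
theorem neg_one_zpow_mul_inv_sub_inv_ne_zero (j : ℤ) :
    ((-1) ^ j * (1 / (2 * j + 1) - 1 / (2 * j - 1)) : ℝ) ≠ 0 := by
  have h1 := Int.two_mul_add_one_cast_ne_zero j
  have h2 := Int.two_mul_sub_one_cast_ne_zero j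
  refine mul_ne_zero (zpow_ne_zero _ (by norm_num)) ?_
  rw [div_sub_div _ _ h1 h2]
  refine div_ne_zero ?_ (mul_ne_zero h1 h2)
  ring_nf
  norm_num

open Real in
/-- In polar coordinates, the rotational average of `(u cos φ + v sin φ)^(2k) |u|` separates. -/
theorem integral_rotate_pow_mul_abs (k : ℕ) (φ u v : ℝ) :
    ∫ θ in (0 : ℝ)..π, (cos φ * (cos θ * u - sin θ * v) + sin φ * (sin θ * u + cos θ * v)) ^ (2 * k)
        * |cos θ * u - sin θ * v| =
      ((u ^ 2 + v ^ 2) ^ k * √(u ^ 2 + v ^ 2)) *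
        ∫ θ in (0 : ℝ)..π, (cos (θ - φ) ^ 2) ^ k * |cos θ| := by
  obtain ⟨r, α, hr, rfl, rfl⟩ : ∃ r α : ℝ, 0 ≤ r ∧ u = r * cos α ∧ v = r * sin α := by
    refine ⟨‖(⟨u, v⟩ : ℂ)‖, Complex.arg ⟨u, v⟩, norm_nonneg _, ?_, ?_⟩
    · rw [Complex.norm_mul_cos_arg]
    · rw [Complex.norm_mul_sin_arg]
  have hsq : (r * cos α) ^ 2 + (r * sin α) ^ 2 = r ^ 2 := by
    linear_combination r ^ 2 * sin_sq_add_cos_sq α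
  have hper : Function.Periodic (fun θ => (cos (θ - φ) ^ 2) ^ k * |cos θ|) π := by
    intro θ
    simp only [show θ + π - φ = θ - φ + π by ring, cos_add_pi, abs_neg, neg_sq]
  rw [hsq, sqrt_sq hr, ← integral_pi_periodic_eq hper α, ← intervalIntegral.integral_const_mul]
  refine intervalIntegral.integral_congr fun θ _ => ?_
  have h1 : cos θ * (r * cos α) - sin θ * (r * sin α) = r * cos (θ + α) := by
    rw [cos_add]; ring
  have h2 : sin θ * (r * cos α) + cos θ * (r * sin α) = r * sin (θ + α) := by
    rw [sin_add]; ring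
  simp only [h1, h2, cos_sub (θ + α) φ, abs_mul, abs_of_nonneg hr, ← pow_mul]
  rw [show cos φ * (r * cos (θ + α)) + sin φ * (r * sin (θ + α)) =
    r * (cos (θ + α) * cos φ + sin (θ + α) * sin φ) by ring, mul_pow]
  ring

/-! ### Invariant integration on the sphere -/

theorem continuous_sphereRotate {d : ℕ}
    (g : EuclideanSpace ℝ (Fin d) ≃ₗᵢ[ℝ] EuclideanSpace ℝ (Fin d)) :
    Continuous (sphereRotate g) :=
  (g.continuous.comp continuous_subtype_val).subtype_mk _

section SphereHaar

variable {d : ℕ} {ω : Measure (Metric.sphere (0 : EuclideanSpace ℝ (Fin d)) 1)}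

theorem IsSphereHaar.integrable (hω : IsSphereHaar ω)
    {f : Metric.sphere (0 : EuclideanSpace ℝ (Fin d)) 1 → ℝ} (hf : Continuous f) :
    Integrable f ω :=
  have := hω.finite
  hf.integrable_of_hasCompactSupport (HasCompactSupport.of_compactSpace f)

/-- Integrals of functions of two orthonormal coordinates do not depend on the coordinates. -/
theorem IsSphereHaar.integral_inner_pair (hω : IsSphereHaar ω) {i j : Fin d} (hij : i ≠ j)
    {x e : EuclideanSpace ℝ (Fin d)} (hx : ‖x‖ = 1) (he : ‖e‖ = 1) (hxe : inner ℝ x e = 0)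
    {f : ℝ → ℝ → ℝ} (hf : Continuous fun z : ℝ × ℝ => f z.1 z.2) :
    ∫ y, f (inner ℝ x (y : EuclideanSpace ℝ (Fin d))) (inner ℝ e (y : EuclideanSpace ℝ (Fin d))) ∂ω
      = ∫ y, f ((y : EuclideanSpace ℝ (Fin d)) i) ((y : EuclideanSpace ℝ (Fin d)) j) ∂ω := by
  have hex : inner ℝ e x = 0 := by rw [real_inner_comm, hxe]
  have hon : Orthonormal ℝ (({i, j} : Set (Fin d)).domRestrict fun k => if k = i then x else e) := by
    constructor
    · rintro ⟨k, hk⟩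
      simp only [Set.domRestrict_apply]
      split_ifs <;> assumption
    · rintro ⟨k, hk⟩ ⟨l, hl⟩ hkl
      have hkl' : k ≠ l := fun h => hkl (Subtype.ext h)
      simp only [Set.domRestrict_apply]
      rcases hk with rfl | rfl <;> rcases hl with rfl | rfl
      · exact absurd rfl hkl'
      · rw [if_pos rfl, if_neg hkl'.symm, hxe]
      · rw [if_neg hkl', if_pos rfl, hex]
      · exact absurd rfl hkl'
  -- The coordinate map of a basis with `x`, `e` in slots `i`, `j` is the orthogonal map to which
  -- invariance applies.
  obtain ⟨b, hb⟩ := hon.exists_orthonormalBasis_extension_of_card_eq (by simp)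
  have hbi : b i = x := by simpa using hb i (by simp)
  have hbj : b j = e := by simpa [hij.symm] using hb j (by simp)
  have hcont : Continuous fun y : Metric.sphere (0 : EuclideanSpace ℝ (Fin d)) 1 =>
      f ((y : EuclideanSpace ℝ (Fin d)) i) ((y : EuclideanSpace ℝ (Fin d)) j) :=
    hf.comp (f := fun y : Metric.sphere (0 : EuclideanSpace ℝ (Fin d)) 1 =>
      (((y : EuclideanSpace ℝ (Fin d)) i), ((y : EuclideanSpace ℝ (Fin d)) j))) (by fun_prop)
  have h := integral_map (μ := ω) (continuous_sphereRotate b.repr).aemeasurable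
    (f := fun y => f ((y : EuclideanSpace ℝ (Fin d)) i) ((y : EuclideanSpace ℝ (Fin d)) j))
    hcont.aestronglyMeasurable
  rw [hω.invariant] at h
  rw [h]
  simp only [sphereRotate, b.repr_apply_apply, hbi, hbj]

/-- All coordinates have the same second moment, and these sum to the total mass. -/
theorem IsSphereHaar.integral_sq_pos (hω : IsSphereHaar ω) {i j : Fin d} (hij : i ≠ j) :
    0 < ∫ y, ((y : EuclideanSpace ℝ (Fin d)) i) ^ 2 ∂ω := by
  have := hω.finite
  refine (integral_nonneg fun y => sq_nonneg _).lt_of_ne' fun h0 => hω.ne_zero ?_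
  have hall : ∀ k : Fin d, ∫ y, ((y : EuclideanSpace ℝ (Fin d)) k) ^ 2 ∂ω = 0 := by
    intro k
    obtain ⟨l, hl⟩ : ∃ l : Fin d, k ≠ l := by
      by_cases hk : k = i
      · exact ⟨j, hk ▸ hij⟩
      · exact ⟨i, hk⟩
    rw [← h0]
    have h := hω.integral_inner_pair hij (x := EuclideanSpace.single k (1 : ℝ))
      (e := EuclideanSpace.single l (1 : ℝ)) (by simp) (by simp)
      (by rw [EuclideanSpace.inner_single_left, PiLp.single_apply, if_neg hl, mul_zero])
      (f := fun u _ => u ^ 2) (by fun_prop)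
    simpa [EuclideanSpace.inner_single_left] using h
  have hsum : ∫ y, ∑ k, ((y : EuclideanSpace ℝ (Fin d)) k) ^ 2 ∂ω = 0 := by
    rw [integral_finsetSum _ fun k _ => hω.integrable (by fun_prop)]
    exact Finset.sum_eq_zero fun k _ => hall k
  have hone : ∀ y : Metric.sphere (0 : EuclideanSpace ℝ (Fin d)) 1,
      ∑ k, ((y : EuclideanSpace ℝ (Fin d)) k) ^ 2 = 1 := fun y => by
    rw [← EuclideanSpace.real_norm_sq_eq, mem_sphere_zero_iff_norm.1 y.2, one_pow]
  simp only [hone, integral_const, smul_eq_mul, mul_one] at hsum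
  rwa [measureReal_eq_zero_iff, Measure.measure_univ_eq_zero] at hsum

theorem IsSphereHaar.integral_radius_ne_zero (hω : IsSphereHaar ω) {i j : Fin d} (hij : i ≠ j)
    (k : ℕ) :
    ∫ y, (((y : EuclideanSpace ℝ (Fin d)) i) ^ 2 + ((y : EuclideanSpace ℝ (Fin d)) j) ^ 2) ^ k *
      √(((y : EuclideanSpace ℝ (Fin d)) i) ^ 2 + ((y : EuclideanSpace ℝ (Fin d)) j) ^ 2) ∂ω ≠ 0 := by
  intro h0
  rw [integral_eq_zero_iff_of_nonneg (fun y => by positivity) (hω.integrable (by fun_prop))] at h0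
  refine (hω.integral_sq_pos hij).ne' (integral_eq_zero_of_ae ?_)
  filter_upwards [h0] with y hy
  have hr : 0 ≤ ((y : EuclideanSpace ℝ (Fin d)) i) ^ 2 + ((y : EuclideanSpace ℝ (Fin d)) j) ^ 2 := by
    positivity
  have hzero : ((y : EuclideanSpace ℝ (Fin d)) i) ^ 2 + ((y : EuclideanSpace ℝ (Fin d)) j) ^ 2 = 0 := by
    rcases mul_eq_zero.1 hy with h | h
    · by_contra hne
      exact pow_ne_zero _ hne h
    · exact (Real.sqrt_eq_zero hr).1 h
  show ((y : EuclideanSpace ℝ (Fin d)) i) ^ 2 = 0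
  nlinarith [sq_nonneg ((y : EuclideanSpace ℝ (Fin d)) i),
    sq_nonneg ((y : EuclideanSpace ℝ (Fin d)) j)]

open Real in
theorem exists_orthogonal_decomposition (hd : 2 ≤ d) {x a : EuclideanSpace ℝ (Fin d)}
    (hx : ‖x‖ = 1) (ha : ‖a‖ = 1) :
    ∃ e : EuclideanSpace ℝ (Fin d), ‖e‖ = 1 ∧ inner ℝ x e = 0 ∧
      a = cos (arccos (inner ℝ a x)) • x + sin (arccos (inner ℝ a x)) • e := by
  set s := inner ℝ a x with hs
  have hle : |s| ≤ 1 := by simpa [hx, ha] using abs_real_inner_le_norm a x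
  rw [cos_arccos (abs_le.1 hle).1 (abs_le.1 hle).2, sin_arccos]
  have hxx : inner ℝ x x = (1 : ℝ) := by rw [real_inner_self_eq_norm_sq, hx, one_pow]
  have horth : inner ℝ x (a - s • x) = 0 := by
    rw [inner_sub_right, inner_smul_right, hxx, real_inner_comm, ← hs, mul_one, sub_self]
  have hnorm : ‖a - s • x‖ ^ 2 = 1 - s ^ 2 := by
    rw [norm_sub_sq_real, inner_smul_right, ← hs, norm_smul, hx, ha, Real.norm_eq_abs, mul_one,
      sq_abs]
    ring
  have hsqrt : √(1 - s ^ 2) = ‖a - s • x‖ := by rw [← hnorm, sqrt_sq (norm_nonneg _)]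
  rw [hsqrt]
  -- If `a = ±x`, any unit vector orthogonal to `x` serves; this needs `2 ≤ d`.
  by_cases h0 : a - s • x = 0
  · have hfin : Fact (Module.finrank ℝ (EuclideanSpace ℝ (Fin d)) = (d - 1) + 1) :=
      ⟨by rw [finrank_euclideanSpace_fin]; omega⟩
    obtain ⟨e, he, hne⟩ : ∃ e ∈ (ℝ ∙ x)ᗮ, e ≠ 0 := by
      refine Submodule.exists_mem_ne_zero_of_ne_bot fun hbot => ?_
      have := Submodule.finrank_orthogonal_span_singleton (𝕜 := ℝ) (n := d - 1) (v := x)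
        (by rintro rfl; simp at hx)
      rw [hbot, finrank_bot] at this
      omega
    rw [Submodule.mem_orthogonal_singleton_iff_inner_right] at he
    refine ⟨(‖e‖⁻¹ : ℝ) • e, ?_, by rw [inner_smul_right, he, mul_zero], ?_⟩
    · rw [norm_smul, norm_inv, norm_norm, inv_mul_cancel₀ (norm_ne_zero_iff.2 hne)]
    · rw [h0, norm_zero, zero_smul, add_zero]
      exact sub_eq_zero.1 h0
  · refine ⟨(‖a - s • x‖⁻¹ : ℝ) • (a - s • x), ?_, by rw [inner_smul_right, horth, mul_zero], ?_⟩
    · rw [norm_smul, norm_inv, norm_norm, inv_mul_cancel₀ (norm_ne_zero_iff.2 h0)]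
    · rw [smul_smul, mul_inv_cancel₀ (norm_ne_zero_iff.2 h0), one_smul]
      abel

open Real in
/-- The cosine transform of an even power of a linear form, as a rotational average. -/
theorem IsSphereHaar.integral_pow_mul_abs_inner (hω : IsSphereHaar ω) {i j : Fin d} (hij : i ≠ j)
    {x a : EuclideanSpace ℝ (Fin d)} (hx : ‖x‖ = 1) (ha : ‖a‖ = 1) (k : ℕ) :
    π * ∫ y, (inner ℝ a (y : EuclideanSpace ℝ (Fin d))) ^ (2 * k) *
        |inner ℝ x (y : EuclideanSpace ℝ (Fin d))| ∂ω =
      (∫ y, (((y : EuclideanSpace ℝ (Fin d)) i) ^ 2 + ((y : EuclideanSpace ℝ (Fin d)) j) ^ 2) ^ k *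
        √(((y : EuclideanSpace ℝ (Fin d)) i) ^ 2 + ((y : EuclideanSpace ℝ (Fin d)) j) ^ 2) ∂ω) *
      ∫ θ in (0 : ℝ)..π, (cos (θ - arccos (inner ℝ a x)) ^ 2) ^ k * |cos θ| := by
  have := hω.finite
  have hd : 2 ≤ d := by
    have := i.2; have := j.2; have := Fin.val_ne_of_ne hij; omega
  obtain ⟨e, he, hxe, hdec⟩ := exists_orthogonal_decomposition hd hx ha
  set φ := arccos (inner ℝ a x)
  let f : ℝ → ℝ → ℝ := fun u v => (cos φ * u + sin φ * v) ^ (2 * k) * |u|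
  have hbase : ∫ y, (inner ℝ a (y : EuclideanSpace ℝ (Fin d))) ^ (2 * k) *
      |inner ℝ x (y : EuclideanSpace ℝ (Fin d))| ∂ω =
      ∫ y, f ((y : EuclideanSpace ℝ (Fin d)) i) ((y : EuclideanSpace ℝ (Fin d)) j) ∂ω := by
    rw [← hω.integral_inner_pair hij hx he hxe (f := f) (by fun_prop)]
    simp only [f]
    rw [hdec]
    simp only [inner_add_left, inner_smul_left, conj_trivial]
  -- Rotating the pair `(x, e)` by `θ` keeps it orthonormal, so the integral is unchanged and can be
  -- averaged over `θ`.
  have hrot : ∀ θ : ℝ, ∫ y, f ((y : EuclideanSpace ℝ (Fin d)) i) ((y : EuclideanSpace ℝ (Fin d)) j) ∂ω =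
      ∫ y, f (cos θ * (y : EuclideanSpace ℝ (Fin d)) i - sin θ * (y : EuclideanSpace ℝ (Fin d)) j)
        (sin θ * (y : EuclideanSpace ℝ (Fin d)) i + cos θ * (y : EuclideanSpace ℝ (Fin d)) j) ∂ω := by
    intro θ
    have hex : inner ℝ e x = 0 := by rw [real_inner_comm, hxe]
    have hsc := sin_sq_add_cos_sq θ
    rw [← hω.integral_inner_pair hij hx he hxe
        (f := fun u v => f (cos θ * u - sin θ * v) (sin θ * u + cos θ * v)) (by fun_prop),
      ← hω.integral_inner_pair hij (x := cos θ • x - sin θ • e) (e := sin θ • x + cos θ • e)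
        ?_ ?_ ?_ (f := f) (by fun_prop)]
    · simp only [inner_add_left, inner_sub_left, inner_smul_left, conj_trivial]
    · rw [← sq_eq_sq₀ (norm_nonneg _) zero_le_one, norm_sub_sq_real]
      simp only [inner_smul_left, inner_smul_right, hxe, norm_smul, hx, he, Real.norm_eq_abs,
        conj_trivial, mul_one, sq_abs]
      linarith
    · rw [← sq_eq_sq₀ (norm_nonneg _) zero_le_one, norm_add_sq_real]
      simp only [inner_smul_left, inner_smul_right, hxe, norm_smul, hx, he, Real.norm_eq_abs,
        conj_trivial, mul_one, sq_abs]
      linarith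
    · simp only [inner_add_right, inner_sub_left, inner_smul_left, inner_smul_right, hxe, hex,
        real_inner_self_eq_norm_sq, hx, he, conj_trivial]
      ring
  have havg : π * ∫ y, f ((y : EuclideanSpace ℝ (Fin d)) i) ((y : EuclideanSpace ℝ (Fin d)) j) ∂ω =
      ∫ θ in (0 : ℝ)..π, ∫ y,
        f (cos θ * (y : EuclideanSpace ℝ (Fin d)) i - sin θ * (y : EuclideanSpace ℝ (Fin d)) j)
        (sin θ * (y : EuclideanSpace ℝ (Fin d)) i + cos θ * (y : EuclideanSpace ℝ (Fin d)) j) ∂ω := by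
    simp only [← hrot]
    simp
  rw [hbase, havg, intervalIntegral_integral_swap]
  · simp only [f, integral_rotate_pow_mul_abs]
    rw [integral_mul_const]
  · have hc : Continuous (Function.uncurry fun (θ : ℝ)
        (y : Metric.sphere (0 : EuclideanSpace ℝ (Fin d)) 1) =>
        f (cos θ * (y : EuclideanSpace ℝ (Fin d)) i - sin θ * (y : EuclideanSpace ℝ (Fin d)) j)
        (sin θ * (y : EuclideanSpace ℝ (Fin d)) i + cos θ * (y : EuclideanSpace ℝ (Fin d)) j)) := by
      simp only [f, Function.uncurry_def]
      fun_prop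
    have hprod : ((volume : Measure ℝ).restrict (Set.uIoc 0 π)).prod ω =
        ((volume : Measure ℝ).prod ω).restrict (Set.uIoc 0 π ×ˢ Set.univ) := by
      rw [← Measure.prod_restrict, Measure.restrict_univ]
    rw [hprod]
    exact (hc.continuousOn.integrableOn_compact (isCompact_uIcc.prod isCompact_univ)).mono_set
      (Set.prod_mono Set.uIoc_subset_uIcc subset_rfl)

end SphereHaar

/-! ### Polarization -/

section PowersSpan

/-- A functional killing `W` but not `w i` would give a nonzero real polynomial vanishing
everywhere. -/
theorem Submodule.mem_of_forall_sum_pow_smul_mem {A : Type*} [AddCommGroup A] [Module ℝ A]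
    (W : Submodule ℝ A) (n : ℕ) (w : ℕ → A)
    (h : ∀ t : ℝ, ∑ i ∈ Finset.range n, t ^ i • w i ∈ W) {i : ℕ} (hi : i < n) : w i ∈ W := by
  by_contra hw
  obtain ⟨f, hf, hfW⟩ := Submodule.exists_le_ker_of_notMem hw
  have hP : ∑ j ∈ Finset.range n, Polynomial.monomial j (f (w j)) = 0 := by
    refine Polynomial.funext fun t => ?_
    have := LinearMap.mem_ker.1 (hfW (h t))
    simp only [map_sum, map_smul, smul_eq_mul] at this
    simpa [Polynomial.eval_finsetSum, mul_comm] using this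
  have := congrArg (fun P => Polynomial.coeff P i) hP
  simp [Polynomial.coeff_monomial, hi] at this
  exact hf this

/-- If a subspace contains the `n`-th powers of the elements of a subspace `L`, then it contains
the products of `n` elements of `L`. -/
theorem Submodule.multiset_prod_mem_of_pow_mem {A : Type*} [CommRing A] [Algebra ℝ A]
    (L W : Submodule ℝ A) {n : ℕ} (h : ∀ l ∈ L, l ^ n ∈ W) (m : Multiset A) (hm : ∀ a ∈ m, a ∈ L)
    (hn : m.card = n) : m.prod ∈ W := by
  -- Factors of `l ^ n` are replaced one at a time by members of `m`; at full cardinality the power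
  -- of `l` is `1`.
  suffices H : ∀ m : Multiset A, (∀ a ∈ m, a ∈ L) → m.card ≤ n →
      ∀ l ∈ L, l ^ (n - m.card) * m.prod ∈ W by
    simpa [hn] using H m hm hn.le 0 L.zero_mem
  intro m
  induction m using Multiset.induction with
  | empty => intro _ _ l hl; simpa using h l hl
  | cons a m ih =>
    intro hm hcard l hl
    rw [Multiset.card_cons] at hcard
    have hm' : ∀ b ∈ m, b ∈ L := fun b hb => hm b (Multiset.mem_cons_of_mem hb)
    obtain ⟨r, hr⟩ : ∃ r, n - m.card = r + 1 := ⟨n - m.card - 1, by omega⟩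
    -- The coefficient of `t` in `(t a + l)^(r+1)` is `(r+1) a l^r`.
    have key := W.mem_of_forall_sum_pow_smul_mem (r + 2)
      (fun i => (a ^ i * l ^ (r + 1 - i) * ((r + 1).choose i : A)) * m.prod) (fun t => by
        have := ih hm' (by omega) (t • a + l)
          (L.add_mem (L.smul_mem t (hm a (Multiset.mem_cons_self a m))) hl)
        rw [hr, add_pow, Finset.sum_mul] at this
        simpa only [smul_pow, smul_mul_assoc] using this) (i := 1) (by omega)
    simp only [pow_one, Nat.choose_one_right, Nat.add_sub_cancel] at key
    rw [Multiset.card_cons, Multiset.prod_cons, show n - (m.card + 1) = r by omega]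
    have h2 := W.smul_mem (((r + 1 : ℕ) : ℝ)⁻¹) key
    have hne : (((r + 1 : ℕ) : ℝ)) ≠ 0 := by positivity
    convert h2 using 1
    have : (((r + 1 : ℕ)) : A) = algebraMap ℝ A ((r + 1 : ℕ) : ℝ) := (map_natCast _ _).symm
    rw [this, Algebra.smul_def]
    have hinv : algebraMap ℝ A (((r + 1 : ℕ) : ℝ)⁻¹) * algebraMap ℝ A ((r + 1 : ℕ) : ℝ) = 1 := by
      rw [← map_mul, inv_mul_cancel₀ hne, map_one]
    linear_combination (-(l ^ r * (a * m.prod))) * hinv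

end PowersSpan

/-! ### The range of the cosine transform -/

section CosineTransform

variable {d : ℕ}

theorem continuous_polyEval (p : MvPolynomial (Fin d) ℝ) : Continuous (polyEval p) := by
  have h := (MvPolynomial.continuous_eval p).comp (PiLp.continuous_ofLp 2 fun _ : Fin d => ℝ)
  exact h

/-- The functions that agree on the unit sphere with the cosine transform of an even polynomial. -/
noncomputable def IsSphereHaar.cosineRange
    {ω : Measure (Metric.sphere (0 : EuclideanSpace ℝ (Fin d)) 1)} (hω : IsSphereHaar ω) :
    Submodule ℝ (EuclideanSpace ℝ (Fin d) → ℝ) where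
  carrier := {f | ∃ q : MvPolynomial (Fin d) ℝ,
    (∀ y : EuclideanSpace ℝ (Fin d), polyEval q (-y) = polyEval q y) ∧
      ∀ x : EuclideanSpace ℝ (Fin d), ‖x‖ = 1 →
        f x = ∫ y : Metric.sphere (0 : EuclideanSpace ℝ (Fin d)) 1,
          polyEval q (y : EuclideanSpace ℝ (Fin d)) *
            |inner ℝ x (y : EuclideanSpace ℝ (Fin d))| ∂ω}
  add_mem' := by
    rintro f g ⟨q, hq, hf⟩ ⟨r, hr, hg⟩
    have hadd : ∀ y, polyEval (q + r) y = polyEval q y + polyEval r y := fun y => map_add _ _ _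
    refine ⟨q + r, fun y => by rw [hadd, hadd, hq, hr], fun x hx => ?_⟩
    rw [Pi.add_apply, hf x hx, hg x hx, ← integral_add]
    · simp only [hadd, add_mul]
    · have := continuous_polyEval q
      exact hω.integrable (by fun_prop)
    · have := continuous_polyEval r
      exact hω.integrable (by fun_prop)
  zero_mem' := ⟨0, fun y => by simp [polyEval], fun x _ => by simp [polyEval]⟩
  smul_mem' := by
    rintro c f ⟨q, hq, hf⟩
    have hsmul : ∀ y, polyEval (c • q) y = c * polyEval q y := fun y => by simp [polyEval]
    refine ⟨c • q, fun y => by rw [hsmul, hsmul, hq], fun x hx => ?_⟩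
    rw [Pi.smul_apply, hf x hx, smul_eq_mul, ← integral_const_mul]
    simp only [hsmul, mul_assoc]

variable {ω : Measure (Metric.sphere (0 : EuclideanSpace ℝ (Fin d)) 1)}

theorem IsSphereHaar.mem_cosineRange_congr (hω : IsSphereHaar ω)
    {f g : EuclideanSpace ℝ (Fin d) → ℝ} (hf : f ∈ hω.cosineRange)
    (hfg : ∀ x, ‖x‖ = 1 → g x = f x) : g ∈ hω.cosineRange := by
  obtain ⟨q, hq, h⟩ := hf
  exact ⟨q, hq, fun x hx => (hfg x hx).trans (h x hx)⟩

theorem polyEval_sum_C_mul_X_pow (a y : EuclideanSpace ℝ (Fin d)) (n : ℕ) :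
    polyEval ((∑ i, MvPolynomial.C (a i) * MvPolynomial.X i) ^ n) y = (inner ℝ a y) ^ n := by
  simp [polyEval, PiLp.inner_apply, mul_comm]

-- The constant `R` depends on `k`, so each monomial of `P` is rescaled separately.
open Real in
theorem IsSphereHaar.average_mem_cosineRange (hω : IsSphereHaar ω) {i j : Fin d} (hij : i ≠ j)
    {a : EuclideanSpace ℝ (Fin d)} (ha : ‖a‖ = 1) (P : Polynomial ℝ) :
    (fun x => ∫ θ in (0 : ℝ)..π, P.eval (cos (θ - arccos (inner ℝ a x)) ^ 2) * |cos θ|) ∈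
      hω.cosineRange := by
  induction P using Polynomial.induction_on' with
  | add P Q hP hQ =>
    convert hω.cosineRange.add_mem hP hQ using 1
    funext x
    rw [Pi.add_apply, ← intervalIntegral.integral_add]
    · simp only [Polynomial.eval_add, add_mul]
    · exact Continuous.intervalIntegrable (by fun_prop) _ _
    · exact Continuous.intervalIntegrable (by fun_prop) _ _
  | monomial k c =>
    have hR := hω.integral_radius_ne_zero hij k
    set R := ∫ y, (((y : EuclideanSpace ℝ (Fin d)) i) ^ 2 +
      ((y : EuclideanSpace ℝ (Fin d)) j) ^ 2) ^ k *
      √(((y : EuclideanSpace ℝ (Fin d)) i) ^ 2 + ((y : EuclideanSpace ℝ (Fin d)) j) ^ 2) ∂ω with hRdef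
    have hmem : (fun x => ∫ y, (inner ℝ a (y : EuclideanSpace ℝ (Fin d))) ^ (2 * k) *
        |inner ℝ x (y : EuclideanSpace ℝ (Fin d))| ∂ω) ∈ hω.cosineRange := by
      refine ⟨(∑ i, MvPolynomial.C (a i) * MvPolynomial.X i) ^ (2 * k), fun y => ?_, fun x _ => ?_⟩
      · rw [polyEval_sum_C_mul_X_pow, polyEval_sum_C_mul_X_pow, inner_neg_right,
          (even_two_mul k).neg_pow]
      · simp only [polyEval_sum_C_mul_X_pow]
    refine hω.mem_cosineRange_congr (hω.cosineRange.smul_mem (c * (π / R)) hmem) fun x hx => ?_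
    have h := hω.integral_pow_mul_abs_inner hij hx ha k
    rw [← hRdef] at h
    simp only [Polynomial.eval_monomial, mul_assoc, Pi.smul_apply, smul_eq_mul]
    rw [intervalIntegral.integral_const_mul, div_mul_eq_mul_div, h, mul_div_cancel_left₀ _ hR]

open Real in
theorem IsSphereHaar.zonal_mem_cosineRange (hω : IsSphereHaar ω) {i j : Fin d} (hij : i ≠ j)
    {a : EuclideanSpace ℝ (Fin d)} (ha : ‖a‖ = 1) (P : Polynomial ℝ) :
    (fun x => P.eval (2 * (inner ℝ a x) ^ 2 - 1)) ∈ hω.cosineRange := by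
  have hP : P ∈ Submodule.span ℝ (Set.range fun j : ℤ => Polynomial.Chebyshev.T ℝ j) := by
    rw [span_range_chebyshev_T]
    trivial
  induction hP using Submodule.span_induction with
  | zero =>
    simp only [Polynomial.eval_zero]
    exact hω.cosineRange.zero_mem
  | add P Q _ _ hP hQ =>
    simp only [Polynomial.eval_add]
    exact hω.cosineRange.add_mem hP hQ
  | smul c P _ hP =>
    simp only [Polynomial.eval_smul]
    exact hω.cosineRange.smul_mem c hP
  | mem P hP =>
    obtain ⟨n, rfl⟩ := hP
    -- Composing with `2X - 1` turns `cos ψ ^ 2` into `cos (2ψ)`, hence `T_n` into `cos (2nψ)`.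
    have h := hω.average_mem_cosineRange hij ha
      ((Polynomial.Chebyshev.T ℝ n).comp (2 * Polynomial.X - 1))
    have hev : ∀ ψ : ℝ, (Polynomial.Chebyshev.T ℝ n).eval (2 * cos ψ ^ 2 - 1) =
        cos (n * (2 * ψ)) := fun ψ => by
      rw [← cos_two_mul, Polynomial.Chebyshev.T_real_cos]
    refine hω.mem_cosineRange_congr (hω.cosineRange.smul_mem
      ((-1) ^ n * (1 / (2 * n + 1) - 1 / (2 * n - 1)))⁻¹ h) ?_
    intro x hx
    have hle : |inner ℝ a x| ≤ 1 := by simpa [hx, ha] using abs_real_inner_le_norm a x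
    simp only [Polynomial.eval_comp, Polynomial.eval_sub, Polynomial.eval_mul,
      Polynomial.eval_X, Polynomial.eval_one, Polynomial.eval_ofNat, hev, Pi.smul_apply,
      smul_eq_mul]
    rw [integral_cos_two_int_mul_sub_mul_abs_cos,
      inv_mul_cancel_left₀ (neg_one_zpow_mul_inv_sub_inv_ne_zero n), ← hev,
      cos_arccos (abs_le.1 hle).1 (abs_le.1 hle).2]

theorem IsSphereHaar.inner_pow_mem_cosineRange (hω : IsSphereHaar ω) {i j : Fin d} (hij : i ≠ j)
    (a : EuclideanSpace ℝ (Fin d)) (k : ℕ) :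
    (fun x => (inner ℝ a x) ^ (2 * k)) ∈ hω.cosineRange := by
  have hunit : ∀ b : EuclideanSpace ℝ (Fin d), ‖b‖ = 1 →
      (fun x => (inner ℝ b x) ^ (2 * k)) ∈ hω.cosineRange := by
    intro b hb
    have h := hω.zonal_mem_cosineRange hij hb
      ((Polynomial.C (1 / 2) * (Polynomial.X + 1)) ^ k)
    convert h using 2 with x
    simp only [Polynomial.eval_pow, Polynomial.eval_mul, Polynomial.eval_add, Polynomial.eval_C,
      Polynomial.eval_X, Polynomial.eval_one]
    rw [pow_mul]
    congr 1
    ring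
  obtain ⟨b, c, hb, rfl⟩ : ∃ (b : EuclideanSpace ℝ (Fin d)) (c : ℝ), ‖b‖ = 1 ∧ a = c • b := by
    by_cases h0 : a = 0
    · exact ⟨EuclideanSpace.single i 1, 0, by simp, by simp [h0]⟩
    · refine ⟨(‖a‖⁻¹ : ℝ) • a, ‖a‖, ?_, ?_⟩
      · rw [norm_smul, norm_inv, norm_norm, inv_mul_cancel₀ (norm_ne_zero_iff.2 h0)]
      · rw [smul_smul, mul_inv_cancel₀ (norm_ne_zero_iff.2 h0), one_smul]
  convert hω.cosineRange.smul_mem (c ^ (2 * k)) (hunit b hb) using 1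
  funext x
  simp [inner_smul_left, mul_pow]

theorem IsSphereHaar.monomial_mem_cosineRange (hω : IsSphereHaar ω) {i j : Fin d} (hij : i ≠ j)
    (m : Multiset (Fin d)) (hm : Even m.card) :
    (m.map fun (l : Fin d) (x : EuclideanSpace ℝ (Fin d)) => x l).prod ∈ hω.cosineRange := by
  obtain ⟨k, hk⟩ := hm
  let φ : EuclideanSpace ℝ (Fin d) →ₗ[ℝ] (EuclideanSpace ℝ (Fin d) → ℝ) :=
    { toFun := fun a x => inner ℝ a x
      map_add' := fun a b => funext fun x => inner_add_left a b x
      map_smul' := fun c a => funext fun x => by simp [inner_smul_left] }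
  refine Submodule.multiset_prod_mem_of_pow_mem (LinearMap.range φ) hω.cosineRange (n := 2 * k)
    ?_ _ ?_ (by rw [Multiset.card_map, hk, two_mul])
  · rintro _ ⟨a, rfl⟩
    exact hω.inner_pow_mem_cosineRange hij a k
  · intro f hf
    obtain ⟨l, _, rfl⟩ := Multiset.mem_map.1 hf
    exact ⟨EuclideanSpace.single l 1, funext fun x => by
      simp [φ, EuclideanSpace.inner_single_left]⟩

/-- Odd-degree monomials cancel and even-degree ones double. On the sphere, an even `p` is half its
symmetrization, even if it is not even as a polynomial. -/
theorem IsSphereHaar.symmetrization_mem_cosineRange (hω : IsSphereHaar ω) {i j : Fin d}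
    (hij : i ≠ j) (p : MvPolynomial (Fin d) ℝ) :
    (fun x => polyEval p x + polyEval p (-x)) ∈ hω.cosineRange := by
  induction p using MvPolynomial.induction_on' with
  | add p q hp hq =>
    convert hω.cosineRange.add_mem hp hq using 1
    funext x
    simp only [polyEval, map_add, Pi.add_apply]
    ring
  | monomial u c =>
    have heval : ∀ x : EuclideanSpace ℝ (Fin d), polyEval (MvPolynomial.monomial u c) x =
        c * ((Finsupp.toMultiset u).map fun l => x l).prod := by
      intro x
      rw [polyEval, MvPolynomial.eval_monomial, Finsupp.toMultiset_map, Finsupp.prod_toMultiset,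
        Finsupp.prod_mapDomain_index (by simp) (by simp [pow_add])]
    have hneg : ∀ x : EuclideanSpace ℝ (Fin d), polyEval (MvPolynomial.monomial u c) (-x) =
        (-1) ^ (Finsupp.toMultiset u).card * polyEval (MvPolynomial.monomial u c) x := by
      intro x
      rw [heval, heval, ← Multiset.card_map (fun l => x l), mul_left_comm, ← Multiset.prod_map_neg,
        Multiset.map_map]
      rfl
    rcases Nat.even_or_odd (Finsupp.toMultiset u).card with h | h
    · convert hω.cosineRange.smul_mem (2 * c) (hω.monomial_mem_cosineRange hij _ h) using 1
      funext x
      have hprod : ((Finsupp.toMultiset u).map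
          fun (l : Fin d) (x : EuclideanSpace ℝ (Fin d)) => x l).prod x =
          ((Finsupp.toMultiset u).map fun l => x l).prod := by
        exact (map_multiset_prod
          (Pi.evalMonoidHom (fun _ : EuclideanSpace ℝ (Fin d) => ℝ) x) _).trans (by rw [Multiset.map_map]; rfl)
      rw [hneg, h.neg_one_pow, heval, Pi.smul_apply, hprod, smul_eq_mul]
      ring
    · convert hω.cosineRange.zero_mem using 1
      funext x
      rw [hneg, h.neg_one_pow, Pi.zero_apply]
      ring

end CosineTransform

theorem mainTheorem4 (d : ℕ) (hd : 2 < d)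
    (ω : MeasureTheory.Measure (Metric.sphere (0 : EuclideanSpace ℝ (Fin d)) 1))
    (hω : IsSphereHaar ω)
    (p : MvPolynomial (Fin d) ℝ)
    (hp : ∀ x : EuclideanSpace ℝ (Fin d), ‖x‖ = 1 → polyEval p (-x) = polyEval p x) :
    ∃ q : MvPolynomial (Fin d) ℝ,
      (∀ y : EuclideanSpace ℝ (Fin d), polyEval q (-y) = polyEval q y) ∧
      ∀ x : EuclideanSpace ℝ (Fin d), ‖x‖ = 1 →
        polyEval p x =
          ∫ y : Metric.sphere (0 : EuclideanSpace ℝ (Fin d)) 1,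
            polyEval q (y : EuclideanSpace ℝ (Fin d)) *
              |inner ℝ x (y : EuclideanSpace ℝ (Fin d))| ∂ω := by
  have hij : (⟨0, by omega⟩ : Fin d) ≠ ⟨1, by omega⟩ := by simp
  have h := hω.cosineRange.smul_mem (1 / 2) (hω.symmetrization_mem_cosineRange hij p)
  refine hω.mem_cosineRange_congr (g := polyEval p) h fun x hx => ?_
  simp only [Pi.smul_apply, hp x hx, smul_eq_mul]
  ring
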